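/- Let $d\ge 1$ and let $\Gamma=(B\sqcup W,E)$ be the $d\times d$ fundamental domain of the hexagonal lattice in the torus: $B=\{{\rm b}_{ij}\}$, $W=\{{\rm w}_{ij}\}$ with $0\le i,j<d$, and each ${\rm w}_{ij}$ is joined by three edges to ${\rm b}_{ij}$, ${\rm b}_{i-1,j}$ and ${\rm b}_{i,j-1}$ (indices modulo $d$). For $\dot x\in\mathbb C^E$ let $K(\dot x)(z,w)$ be the Kasteleyn matrix, $K(\dot x)(z,w)_{{\rm w},{\rm b}}=\sum_{e}\dot x(e)\,z^{m(e)}w^{n(e)}$, the sum being over the edges $e$ joining ${\rm b}$ and ${\rm w}$, where $m(e)=1$ for the edges ${\rm w}_{0j}{\rm b}_{-1,j}$ (and $m(e)=0$ otherwise) and $n(e)=1$ for the edges ${\rm w}_{i0}{\rm b}_{i,-1}$ (and $n(e)=0$ otherwise). Let $G=\boldsymbol\mu_d^3/\boldsymbol\mu_d$ act on $\mathbb P^2_{\mathbb C}$ by $[x_0:x_1:x_2]\mapsto[\zeta_0x_0:\zeta_1x_1:\zeta_2x_2]$, and for $r\in\mathbb Z^3$ let $\mathcal O^G(r_0D_0+r_1D_1+r_2D_2)$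 be the line bundle $\mathcal O(r_0+r_1+r_2)$ on $\mathbb P^2$ with the linearization induced by $(u,t)\mapsto(\zeta u,\zeta_0^{r_0}\zeta_1^{r_1}\zeta_2^{r_2}t)$ on $(\mathbb C^3\setminus 0)\times\mathbb C$. Let ${\bf d}$ be the discrete Abel map: ${\bf d}({\rm w}_{00})=0$, and ${\bf d}({\rm b})={\bf d}({\rm w})+D_i+D_j$ for every edge ${\rm b}{\rm w}$ inside the fundamental domain (that is, with $m(e)=n(e)=0$), where $Z_i$ and $Z_j$ are the families of the two zig-zag paths through the edge ($Z_0,Z_1,Z_2$ being the zig-zag paths with homology class $(-1,1),(0,-1),(1,0)$); explicitly, ${\bf d}({\rm w}_{ij})=i(D_1-D_0)+j(D_2-D_0)$ and ${\bf d}({\rm b}_{ij})={\bf d}({\rm w}_{ij})+D_1+D_2$. Put $\mathcal E_{\rm b}=\mathcal O^G({\bf d}({\rm b})-D_0-D_1-D_2)$, $\mathcal F_{\rm w}=\mathcal O^G({\bf d}({\rm w}))$, $\mathcal E=\bigoplus_{{\rm b}\in B}\mathcal E_{\rm b}$ and $\mathcal F=\bigoplus_{{\rm w}\in W}\mathcal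 F_{\rm w}$. Say that a homomorphism of sheaves of $\mathcal O_{\mathbb P^2}$-modules $\mathcal E\to\mathcal F$ extends $K(\dot x)$ if over the torus $\{x_0x_1x_2\ne0\}$, in the trivializations of the summands by the $G$-invariant sections $x_0^{r_0}x_1^{r_1}x_2^{r_2}$, it is the matrix $K(\dot x)(z,w)$ with $z=(x_1/x_0)^d$ and $w=(x_2/x_0)^d$. Then for every $\dot x\in\mathbb C^E$ there is exactly one homomorphism $\widetilde K(\dot x):\mathcal E\to\mathcal F$ extending $K(\dot x)$; it is $G$-invariant, and the map $\mathbb C^E\to\operatorname{Hom}(\mathcal E,\mathcal F)^G$, $\dot x\mapsto\widetilde K(\dot x)$, is an isomorphism of $\mathbb C$-vector spaces. In particular, every $G$-invariant map $\mathcal E\to\mathcal F$ is the extension of a Kasteleyn matrix. Moreover, for all ${\rm b}\in B$ and ${\rm w}\in W$, the dimension of $\operatorname{Hom}(\mathcal E_{\rm b},\mathcal F_{\rm w})^G$ is the number of edges joining ${\rm b}$ and ${\rm w}$; so, if $d\ge2$, it is $1$ if ${\rm b}{\rm w}$ is an edge of $\Gamma$ and $0$ otherwise. -/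

import Mathlib

namespace DimerP2

/-! ### The `d × d` fundamental domain of the hexagonal lattice in the torus

The universal cover has a white vertex `w(i,j)` and a black vertex `b(i,j)` for every
`(i,j) ∈ ℤ²`; the vertex `w(i,j)` is joined to `b(i,j)` (type `0`), `b(i-1,j)` (type `1`) and
`b(i,j-1)` (type `2`). The graph `Γ` in the torus is the quotient by `d ℤ²`; the fundamental
domain is `0 ≤ i, j < d`, with `(0,0)` at the bottom left. -/

/-- White vertices of `Γ`. -/
abbrev White (d : ℕ) : Type := Fin d × Fin d

/-- Black vertices of `Γ`. -/
abbrev Black (d : ℕ) : Type := Fin d × Fin d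

/-- Edges of `Γ`: a white end together with a type in `{0,1,2}`. -/
abbrev Edge (d : ℕ) : Type := (Fin d × Fin d) × Fin 3

/-- In the universal cover an edge of type `k` joins `w(p)` to `b(p + shift k)`. -/
def shift : Fin 3 → ℤ × ℤ := ![(0, 0), (-1, 0), (0, -1)]

variable {d : ℕ}

/-- The white end of an edge. -/
def Edge.white (e : Edge d) : White d := e.1

/-- The black end of an edge (indices are cyclic modulo `d`). -/
def Edge.black [NeZero d] (e : Edge d) : Black d :=
  ![(e.1.1, e.1.2), (e.1.1 - 1, e.1.2), (e.1.1, e.1.2 - 1)] e.2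

/-- The exponent of `z` of an edge, i.e. its intersection index `(e, γ₂)` with the right side of
the fundamental domain. -/
def Edge.crossZ [NeZero d] (e : Edge d) : ℤ := if e.2 = 1 ∧ e.1.1 = 0 then 1 else 0

/-- The exponent of `w` of an edge, i.e. minus its intersection index `(e, γ₁)` with the upper side
of the fundamental domain. -/
def Edge.crossW [NeZero d] (e : Edge d) : ℤ := if e.2 = 2 ∧ e.1.2 = 0 then 1 else 0

/-- The edge lies inside the fundamental domain: it crosses neither `γ₁` nor `γ₂`. -/
def Edge.IsInside [NeZero d] (e : Edge d) : Prop := e.crossZ = 0 ∧ e.crossW = 0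

/-- Two vertices of opposite colours are adjacent in `Γ`. -/
def Adjacent [NeZero d] (b : Black d) (w : White d) : Prop :=
  ∃ e : Edge d, Edge.black e = b ∧ Edge.white e = w

/-! ### Zig-zag paths

Around a black vertex, and around a white vertex, the edges of types `0, 1, 2` are in
counterclockwise order. Turning maximally right at black vertices and maximally left at white ones,
a zig-zag path which arrives at a black vertex along an edge of type `k` leaves it along the edge
of type `k + 1` and leaves the next white vertex along the edge of type `k` again. -/

/-- The displacement, in the universal cover, of two consecutive edges (white to black to white) of
a zig-zag path that traverses edges of type `k` from white to black. The path closes up in the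
torus after `d` such steps, so this is its homology class in the basis `(γ₁, γ₂)`. -/
def zigzagStep (k : Fin 3) : ℤ × ℤ := shift k - shift (k + 1)

/-- The homology classes of the three families `Z₀, Z₁, Z₂` of zig-zag paths. -/
def zigzagClass : Fin 3 → ℤ × ℤ := ![(-1, 1), (0, -1), (1, 0)]

/-- The index of the family containing the zig-zag path that traverses an edge of type `k` from
white to black. -/
def leftFamily (k : Fin 3) : Fin 3 := k + 2

/-- The index of the family containing the zig-zag path that traverses an edge of type `k` from
black to white. -/
def rightFamily (k : Fin 3) : Fin 3 := k + 1

theorem zigzagClass_leftFamily (k : Fin 3) : zigzagClass (leftFamily k) = zigzagStep k := by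
  fin_cases k <;> decide

theorem zigzagClass_rightFamily (k : Fin 3) :
    zigzagClass (rightFamily k) = zigzagStep (k - 1) := by
  fin_cases k <;> decide

/-! ### The discrete Abel map

Divisors `r₀ D₀ + r₁ D₁ + r₂ D₂` are written as functions `Fin 3 → ℤ`. -/

/-- The divisor `D_k`. -/
def coordDivisor (k : Fin 3) : Fin 3 → ℤ := Pi.single k 1

/-- The discrete Abel map on white vertices. -/
def abelWhite (w : White d) : Fin 3 → ℤ :=
  (w.1 : ℤ) • (coordDivisor 1 - coordDivisor 0) + (w.2 : ℤ) • (coordDivisor 2 - coordDivisor 0)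

/-- The discrete Abel map on black vertices. -/
def abelBlack (b : Black d) : Fin 3 → ℤ :=
  (b.1 : ℤ) • (coordDivisor 1 - coordDivisor 0) + (b.2 : ℤ) • (coordDivisor 2 - coordDivisor 0)
    + coordDivisor 1 + coordDivisor 2

/-- The properties that define the discrete Abel map: it vanishes at the bottom left white vertex
and it changes by `D_i + D_j` along an edge inside the fundamental domain that is contained in
zig-zag paths of the families `Z_i` and `Z_j`. -/
def IsDiscreteAbelMap [NeZero d] (dB : Black d → Fin 3 → ℤ) (dW : White d → Fin 3 → ℤ) : Prop :=
  dW (0, 0) = 0 ∧ ∀ e : Edge d, Edge.IsInside e →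
    dB (Edge.black e) = dW (Edge.white e) + coordDivisor (leftFamily e.2)
      + coordDivisor (rightFamily e.2)

theorem val_sub_one [NeZero d] (i : Fin d) (hi : i ≠ 0) : ((i - 1 : Fin d) : ℤ) = (i : ℤ) - 1 := by
  have h1 : 1 ≤ i.val := Nat.one_le_iff_ne_zero.mpr (fun h => hi (Fin.ext (by simpa using h)))
  have hd : 1 < d := lt_of_le_of_lt h1 i.isLt
  have h2 : ((1 : Fin d) : ℕ) = 1 := by
    rw [Fin.val_one', Nat.mod_eq_of_lt hd]
  have h3 : ((i - 1 : Fin d) : ℕ) = (i : ℕ) - 1 := by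
    rw [Fin.sub_val_of_le (by rw [Fin.le_def, h2]; exact h1), h2]
  omega

/-- The explicit formulas above do give the discrete Abel map. -/
theorem isDiscreteAbelMap_abel [NeZero d] :
    IsDiscreteAbelMap (d := d) abelBlack abelWhite := by
  refine ⟨by simp [abelWhite], ?_⟩
  rintro ⟨⟨i, j⟩, k⟩ ⟨hz, hw⟩
  fin_cases k
  · simp [Edge.black, Edge.white, abelBlack, abelWhite, leftFamily, rightFamily]
    abel
  · have hi : i ≠ 0 := fun h => by simp [Edge.crossZ, h] at hz
    simp only [Edge.black, Edge.white, abelBlack, abelWhite, leftFamily, rightFamily]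
    simp [val_sub_one i hi, sub_smul, show (1 + 2 : Fin 3) = 0 from rfl,
      show (1 + 1 : Fin 3) = 2 from rfl]
    abel
  · have hj : j ≠ 0 := fun h => by simp [Edge.crossW, h] at hw
    simp only [Edge.black, Edge.white, abelBlack, abelWhite, leftFamily, rightFamily]
    simp [val_sub_one j hj, sub_smul, show (2 + 2 : Fin 3) = 1 from rfl,
      show (2 + 1 : Fin 3) = 0 from rfl]
    abel

/-- The discrete Abel map is the only one with these properties. -/
theorem IsDiscreteAbelMap.eq_abel [NeZero d] {dB : Black d → Fin 3 → ℤ} {dW : White d → Fin 3 → ℤ}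
    (h : IsDiscreteAbelMap dB dW) : dB = abelBlack ∧ dW = abelWhite := by
  obtain ⟨h0, he⟩ := h
  obtain ⟨g0, ge⟩ := isDiscreteAbelMap_abel (d := d)
  have key : ∀ e : Edge d, Edge.IsInside e →
      (dB (Edge.black e) = abelBlack (Edge.black e) ↔
        dW (Edge.white e) = abelWhite (Edge.white e)) := by
    intro e hin
    rw [he e hin, ge e hin]
    simp
  have k0 : ∀ i j : Fin d, dB (i, j) = abelBlack (i, j) ↔ dW (i, j) = abelWhite (i, j) :=
    fun i j => key ((i, j), 0) ⟨by simp [Edge.crossZ], by simp [Edge.crossW]⟩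
  have k1 : ∀ i j : Fin d, i ≠ 0 →
      (dB (i - 1, j) = abelBlack (i - 1, j) ↔ dW (i, j) = abelWhite (i, j)) :=
    fun i j hi => key ((i, j), 1) ⟨by simp [Edge.crossZ, hi], by simp [Edge.crossW]⟩
  have k2 : ∀ i j : Fin d, j ≠ 0 →
      (dB (i, j - 1) = abelBlack (i, j - 1) ↔ dW (i, j) = abelWhite (i, j)) :=
    fun i j hj => key ((i, j), 2) ⟨by simp [Edge.crossZ], by simp [Edge.crossW, hj]⟩
  have hrow : ∀ (n : ℕ) (i : Fin d), (i : ℕ) = n → dW (i, 0) = abelWhite (i, 0) := by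
    intro n
    induction n with
    | zero =>
      intro i hi
      have : i = 0 := Fin.ext (by simpa using hi)
      rw [this, h0, g0]
    | succ n ih =>
      intro i hi
      have hi0 : i ≠ 0 := fun h => by simp [h] at hi
      have hv := val_sub_one i hi0
      exact (k1 i 0 hi0).mp ((k0 (i - 1) 0).mpr (ih _ (by omega)))
  have hall : ∀ (n : ℕ) (i j : Fin d), (j : ℕ) = n → dW (i, j) = abelWhite (i, j) := by
    intro n
    induction n with
    | zero =>
      intro i j hj
      have : j = 0 := Fin.ext (by simpa using hj)
      rw [this]
      exact hrow _ i rfl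
    | succ n ih =>
      intro i j hj
      have hj0 : j ≠ 0 := fun h => by simp [h] at hj
      have hv := val_sub_one j hj0
      exact (k2 i j hj0).mp ((k0 i (j - 1)).mpr (ih i _ (by omega)))
  exact ⟨funext fun b => (k0 b.1 b.2).mpr (hall _ b.1 b.2 rfl),
    funext fun w => hall _ w.1 w.2 rfl⟩

/-! ### The Kasteleyn matrix -/

/-- The Kasteleyn matrix `K(x)(z,w)` of a function `x` on the edges, for `z, w ∈ ℂ^×`. -/
noncomputable def kasteleyn [NeZero d] (x : Edge d → ℂ) (z w : ℂ) :
    Matrix (White d) (Black d) ℂ :=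
  fun v b => ∑ e : Edge d with Edge.black e = b ∧ Edge.white e = v,
    x e * z ^ Edge.crossZ e * w ^ Edge.crossW e

/-! ### The projective plane with its Zariski topology -/

/-- The (closed points of the) complex projective plane. -/
def P2 : Type := Projectivization ℂ (Fin 3 → ℂ)

/-- The point `[u₀ : u₁ : u₂]`. -/
noncomputable def P2.mk (u : Fin 3 → ℂ) (hu : u ≠ 0) : P2 := Projectivization.mk ℂ u hu

/-- The locus where a homogeneous polynomial does not vanish. -/
def basicOpen (p : MvPolynomial (Fin 3) ℂ) : Set P2 :=
  {P | MvPolynomial.eval (Projectivization.rep P) p ≠ 0}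

/-- The Zariski topology. -/
noncomputable instance : TopologicalSpace P2 :=
  TopologicalSpace.generateFrom
    {V | ∃ (n : ℕ) (p : MvPolynomial (Fin 3) ℂ), p.IsHomogeneous n ∧ V = basicOpen p}

theorem eval_smul_of_isHomogeneous {n : ℕ} {p : MvPolynomial (Fin 3) ℂ} (hp : p.IsHomogeneous n)
    (a : ℂ) (u : Fin 3 → ℂ) :
    MvPolynomial.eval (a • u) p = a ^ n * MvPolynomial.eval u p := by
  rw [MvPolynomial.eval_eq, MvPolynomial.eval_eq, Finset.mul_sum]
  refine Finset.sum_congr rfl fun m hm => ?_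
  have hdeg := hp.degree_eq_sum_deg_support hm
  simp only [Pi.smul_apply, smul_eq_mul, mul_pow, Finset.prod_mul_distrib]
  rw [Finset.prod_pow_eq_pow_sum, hdeg]
  ring

theorem mk_mem_basicOpen {n : ℕ} {p : MvPolynomial (Fin 3) ℂ} (hp : p.IsHomogeneous n)
    (u : Fin 3 → ℂ) (hu : u ≠ 0) :
    P2.mk u hu ∈ basicOpen p ↔ MvPolynomial.eval u p ≠ 0 := by
  obtain ⟨a, ha⟩ := Projectivization.exists_smul_eq_mk_rep ℂ u hu
  change MvPolynomial.eval (Projectivization.mk ℂ u hu).rep p ≠ 0 ↔ _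
  rw [← ha, Units.smul_def, eval_smul_of_isHomogeneous hp]
  simp

open TopologicalSpace (Opens)

/-- The punctured affine cone over a subset of the plane: the nonzero vectors representing its
points. -/
def cone (V : Opens P2) : Set (Fin 3 → ℂ) := {u | ∃ hu : u ≠ 0, P2.mk u hu ∈ V}

/-! ### Line bundles `𝒪(n)` and direct sums of line bundles -/

/-- `s` is a section of `𝒪(n)` over `V`: a function on the punctured cone over `V` which is locally
a quotient `p / q` of homogeneous polynomials with `deg p - deg q = n`. -/
def IsSection (n : ℤ) (V : Opens P2) (s : cone V → ℂ) : Prop :=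
  ∀ u : cone V, ∃ (k l : ℕ) (p q : MvPolynomial (Fin 3) ℂ),
    p.IsHomogeneous k ∧ q.IsHomogeneous l ∧ (k : ℤ) - l = n ∧
    MvPolynomial.eval u.1 q ≠ 0 ∧
    ∀ v : cone V, MvPolynomial.eval v.1 q ≠ 0 →
      s v = MvPolynomial.eval v.1 p / MvPolynomial.eval v.1 q

theorem IsSection.add {n : ℤ} {V : Opens P2} {s t : cone V → ℂ} (hs : IsSection n V s)
    (ht : IsSection n V t) : IsSection n V (s + t) := by
  intro u
  obtain ⟨k, l, p, q, hp, hq, hkl, hu, h⟩ := hs u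
  obtain ⟨k', l', p', q', hp', hq', hkl', hu', h'⟩ := ht u
  refine ⟨k + l', l + l', p * q' + q * p', q * q', (hp.mul hq').add ?_, hq.mul hq', ?_, ?_, ?_⟩
  · have : k + l' = l + k' := by omega
    rw [this]
    exact hq.mul hp'
  · push_cast; omega
  · simpa using ⟨hu, hu'⟩
  · intro v hv
    have hv2 : MvPolynomial.eval v.1 q ≠ 0 ∧ MvPolynomial.eval v.1 q' ≠ 0 := by simpa using hv
    rw [Pi.add_apply, h v hv2.1, h' v hv2.2, div_add_div _ _ hv2.1 hv2.2]
    simp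

theorem IsSection.mul {m n : ℤ} {V : Opens P2} {f s : cone V → ℂ} (hf : IsSection m V f)
    (hs : IsSection n V s) : IsSection (m + n) V (f * s) := by
  intro u
  obtain ⟨k, l, p, q, hp, hq, hkl, hu, h⟩ := hf u
  obtain ⟨k', l', p', q', hp', hq', hkl', hu', h'⟩ := hs u
  refine ⟨k + k', l + l', p * p', q * q', hp.mul hp', hq.mul hq', ?_, ?_, ?_⟩
  · push_cast; omega
  · simpa using ⟨hu, hu'⟩
  · intro v hv
    have hv2 : MvPolynomial.eval v.1 q ≠ 0 ∧ MvPolynomial.eval v.1 q' ≠ 0 := by simpa using hv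
    rw [Pi.mul_apply, h v hv2.1, h' v hv2.2, div_mul_div_comm]
    simp

theorem isSection_const (V : Opens P2) (c : ℂ) : IsSection 0 V (fun _ => c) := fun _ =>
  ⟨0, 0, MvPolynomial.C c, 1, MvPolynomial.isHomogeneous_C _ _, MvPolynomial.isHomogeneous_one _ _,
    by simp, by simp, fun v _ => by simp⟩

theorem IsSection.const_mul {n : ℤ} {V : Opens P2} {s : cone V → ℂ} (hs : IsSection n V s) (c : ℂ) :
    IsSection n V (c • s) := by
  have h := (isSection_const V c).mul hs
  rw [zero_add] at h
  exact h

theorem isSection_zero (n : ℤ) (V : Opens P2) : IsSection n V 0 := by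
  intro u
  obtain ⟨hu, -⟩ := u.2
  obtain ⟨k, hk⟩ : ∃ k, u.1 k ≠ 0 := Function.ne_iff.mp hu
  refine ⟨n.toNat, (-n).toNat, 0, MvPolynomial.X k ^ (-n).toNat,
    MvPolynomial.isHomogeneous_zero _ _ _, MvPolynomial.isHomogeneous_X_pow _ _, by omega, ?_, ?_⟩
  · simp [hk]
  · simp

theorem IsSection.smul_apply {n : ℤ} {V : Opens P2} {s : cone V → ℂ} (hs : IsSection n V s)
    (u v : cone V) (a : ℂ) (ha : a ≠ 0) (huv : v.1 = a • u.1) : s v = a ^ n * s u := by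
  obtain ⟨k, l, p, q, hp, hq, hkl, hu, h⟩ := hs u
  have hv : MvPolynomial.eval v.1 q ≠ 0 := by
    rw [huv, eval_smul_of_isHomogeneous hq]
    exact mul_ne_zero (pow_ne_zero _ ha) hu
  rw [h v hv, h u hu, huv, eval_smul_of_isHomogeneous hq, eval_smul_of_isHomogeneous hp, ← hkl,
    zpow_sub₀ ha, zpow_natCast, zpow_natCast, mul_div_mul_comm]

/-- Sections over `V` of the direct sum, over the index type `ι`, of the line bundles
`𝒪(r_{i,0} D₀ + r_{i,1} D₁ + r_{i,2} D₂)` of degree `r_{i,0} + r_{i,1} + r_{i,2}`. -/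
def sections {ι : Type} (r : ι → Fin 3 → ℤ) (V : Opens P2) : Submodule ℂ (ι → cone V → ℂ) where
  carrier := {s | ∀ i, IsSection (∑ k, r i k) V (s i)}
  add_mem' hs ht i := (hs i).add (ht i)
  zero_mem' _ := isSection_zero _ V
  smul_mem' c _ hs i := (hs i).const_mul c

section Sheaf

variable {ι κ : Type} {r : ι → Fin 3 → ℤ} {r' : κ → Fin 3 → ℤ}

/-- Multiplication of a section by a regular function (a section of `𝒪`). -/
def mulSection {V : Opens P2} (f : cone V → ℂ) (hf : IsSection 0 V f) (s : sections r V) :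
    sections r V :=
  ⟨fun i => f * s.1 i, fun i => by
    have h := hf.mul (s.2 i)
    rw [zero_add] at h
    exact h⟩

theorem cone_mono {V W : Opens P2} (h : V ≤ W) : cone V ⊆ cone W :=
  fun _ hu => ⟨hu.1, h hu.2⟩

/-- Restriction of sections. -/
def restrict {V W : Opens P2} (h : V ≤ W) (s : sections r W) : sections r V :=
  ⟨fun i u => s.1 i ⟨u.1, cone_mono h u.2⟩, fun i u => by
    obtain ⟨k, l, p, q, hp, hq, hkl, hu, hv⟩ := s.2 i ⟨u.1, cone_mono h u.2⟩
    exact ⟨k, l, p, q, hp, hq, hkl, hu, fun v hvq => hv ⟨v.1, cone_mono h v.2⟩ hvq⟩⟩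

variable (r r') in
/-- Homomorphisms of sheaves of `𝒪`-modules: families of maps of sections over all opens, linear
over the regular functions and compatible with restriction. -/
def sheafHom : Submodule ℂ (∀ V : Opens P2, sections r V →ₗ[ℂ] sections r' V) where
  carrier := {φ |
    (∀ (V : Opens P2) (f : cone V → ℂ) (hf : IsSection 0 V f) (s : sections r V),
      φ V (mulSection f hf s) = mulSection f hf (φ V s)) ∧
    (∀ (V W : Opens P2) (h : V ≤ W) (s : sections r W),
      φ V (restrict h s) = restrict h (φ W s))}
  add_mem' := by
    rintro φ ψ ⟨h1, h2⟩ ⟨h3, h4⟩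
    refine ⟨fun V f hf s => ?_, fun V W h s => ?_⟩
    · simp only [Pi.add_apply, LinearMap.add_apply, h1, h3]
      ext i u
      simp [mulSection, mul_add]
    · simp only [Pi.add_apply, LinearMap.add_apply, h2, h4]
      rfl
  zero_mem' := by
    refine ⟨fun V f hf s => ?_, fun V W h s => ?_⟩
    · ext i u
      simp [mulSection]
    · rfl
  smul_mem' := by
    rintro c φ ⟨h1, h2⟩
    refine ⟨fun V f hf s => ?_, fun V W h s => ?_⟩
    · simp only [Pi.smul_apply, LinearMap.smul_apply, h1]
      ext i u
      simp [mulSection]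
    · simp only [Pi.smul_apply, LinearMap.smul_apply, h2]
      rfl

end Sheaf

/-! ### The action of `G = μ_d³ / μ_d` -/

/-- The group `μ_d³`. The group `G` is its quotient by the diagonal, which acts trivially on the
plane and on all the bundles below (see `scale_diagonal` and `pullback_diagonal`); so being
invariant under `G` is the same as being invariant under this group. -/
abbrev MuCubed (d : ℕ) : Type := Fin 3 → rootsOfUnity d ℂ

/-- The entries of an element of `μ_d³` as complex numbers. -/
noncomputable def MuCubed.coord (ζ : MuCubed d) (k : Fin 3) : ℂ := ((ζ k : ℂˣ) : ℂ)

/-- The linear automorphism `u ↦ (ζ₀ u₀, ζ₁ u₁, ζ₂ u₂)`. -/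
noncomputable def scaleVec (ζ : MuCubed d) (u : Fin 3 → ℂ) : Fin 3 → ℂ := fun k => MuCubed.coord ζ k * u k

theorem MuCubed.coord_ne_zero (ζ : MuCubed d) (k : Fin 3) : MuCubed.coord ζ k ≠ 0 :=
  Units.ne_zero _

theorem scaleVec_ne_zero (ζ : MuCubed d) {u : Fin 3 → ℂ} (hu : u ≠ 0) : scaleVec ζ u ≠ 0 := by
  obtain ⟨k, hk⟩ := Function.ne_iff.mp hu
  exact Function.ne_iff.mpr ⟨k, mul_ne_zero (MuCubed.coord_ne_zero ζ k) hk⟩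

/-- The action on the plane: `[u₀ : u₁ : u₂] ↦ [ζ₀ u₀ : ζ₁ u₁ : ζ₂ u₂]`. -/
noncomputable def scale (ζ : MuCubed d) (P : P2) : P2 :=
  Projectivization.lift (fun u => P2.mk (scaleVec ζ u.1) (scaleVec_ne_zero ζ u.2))
    (fun a b t h => (Projectivization.mk_eq_mk_iff' ℂ _ _ _ _).mpr ⟨t, by
      funext k
      simp only [h, scaleVec, Pi.smul_apply, smul_eq_mul]
      ring⟩) P

theorem scale_mk (ζ : MuCubed d) (u : Fin 3 → ℂ) (hu : u ≠ 0) :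
    scale ζ (P2.mk u hu) = P2.mk (scaleVec ζ u) (scaleVec_ne_zero ζ hu) := rfl

theorem P2.ind {p : P2 → Prop} (h : ∀ u hu, p (P2.mk u hu)) (P : P2) : p P :=
  Projectivization.ind h P

/-- The polynomial `p(ζ₀ x₀, ζ₁ x₁, ζ₂ x₂)`. -/
noncomputable def scalePoly (ζ : MuCubed d) (p : MvPolynomial (Fin 3) ℂ) :
    MvPolynomial (Fin 3) ℂ :=
  MvPolynomial.aeval (fun k => MvPolynomial.C (MuCubed.coord ζ k) * MvPolynomial.X k) p

theorem eval_scalePoly (ζ : MuCubed d) (p : MvPolynomial (Fin 3) ℂ) (u : Fin 3 → ℂ) :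
    MvPolynomial.eval u (scalePoly ζ p) = MvPolynomial.eval (scaleVec ζ u) p := by
  induction p using MvPolynomial.induction_on with
  | C a => simp [scalePoly]
  | add p q hp hq =>
    rw [map_add, ← hp, ← hq, scalePoly, map_add, map_add]
    rfl
  | mul_X p k hp =>
    rw [map_mul, ← hp, scalePoly, map_mul, map_mul]
    simp [scalePoly, scaleVec]

theorem scalePoly_isHomogeneous (ζ : MuCubed d) {n : ℕ} {p : MvPolynomial (Fin 3) ℂ}
    (hp : p.IsHomogeneous n) : (scalePoly ζ p).IsHomogeneous n := by
  have h := hp.aeval (fun k => MvPolynomial.C (MuCubed.coord ζ k) * MvPolynomial.X k)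
    (n := 1) (fun k => MvPolynomial.isHomogeneous_C_mul_X _ k)
  rwa [one_mul] at h

theorem continuous_scale (ζ : MuCubed d) : Continuous (scale ζ) := by
  refine continuous_generateFrom_iff.mpr ?_
  rintro _ ⟨n, p, hp, rfl⟩
  refine TopologicalSpace.isOpen_generateFrom_of_mem
    ⟨n, scalePoly ζ p, scalePoly_isHomogeneous ζ hp, ?_⟩
  ext P
  induction P using P2.ind with
  | h u hu =>
    rw [Set.mem_preimage, scale_mk, mk_mem_basicOpen hp,
      mk_mem_basicOpen (scalePoly_isHomogeneous ζ hp), eval_scalePoly]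

/-- The open set `ζ⁻¹ V`. -/
noncomputable def preOpen (ζ : MuCubed d) (V : Opens P2) : Opens P2 :=
  ⟨scale ζ ⁻¹' V, V.isOpen.preimage (continuous_scale ζ)⟩

theorem scaleVec_mem_cone (ζ : MuCubed d) {V : Opens P2} {u : Fin 3 → ℂ}
    (hu : u ∈ cone (preOpen ζ V)) : scaleVec ζ u ∈ cone V :=
  ⟨scaleVec_ne_zero ζ hu.1, hu.2⟩

/-- The character `ζ₀^{r₀} ζ₁^{r₁} ζ₂^{r₂}`. -/
noncomputable def weight (ζ : MuCubed d) (r : Fin 3 → ℤ) : ℂ := ∏ k, MuCubed.coord ζ k ^ r k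

section Action

variable {ι κ : Type} {r : ι → Fin 3 → ℤ} {r' : κ → Fin 3 → ℤ}

/-- The `G`-linearization of `𝒪^G(r₀ D₀ + r₁ D₁ + r₂ D₂)` is the action
`(u, t) ↦ (ζ u, ζ₀^{r₀} ζ₁^{r₁} ζ₂^{r₂} t)` on (the pullback to the cone of) its total space. So
`ζ⁻¹` sends a section `s` over `V` to the section `u ↦ ζ^{-r} s(ζ u)` over `ζ⁻¹ V`. -/
noncomputable def pullback (ζ : MuCubed d) {V : Opens P2} (s : sections r V) :
    sections r (preOpen ζ V) :=
  ⟨fun i u => (weight ζ (r i))⁻¹ * s.1 i ⟨scaleVec ζ u.1, scaleVec_mem_cone ζ u.2⟩, fun i => by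
    refine IsSection.const_mul (s := fun u : cone (preOpen ζ V) =>
      s.1 i ⟨scaleVec ζ u.1, scaleVec_mem_cone ζ u.2⟩) (fun u => ?_) _
    obtain ⟨k, l, p, q, hp, hq, hkl, hu, hv⟩ := s.2 i ⟨scaleVec ζ u.1, scaleVec_mem_cone ζ u.2⟩
    refine ⟨k, l, scalePoly ζ p, scalePoly ζ q, scalePoly_isHomogeneous ζ hp,
      scalePoly_isHomogeneous ζ hq, hkl, ?_, fun v hvq => ?_⟩
    · rwa [eval_scalePoly]
    · rw [eval_scalePoly] at hvq ⊢
      rw [eval_scalePoly]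
      exact hv ⟨scaleVec ζ v.1, scaleVec_mem_cone ζ v.2⟩ hvq⟩

variable (d r r') in
/-- `Hom(𝓔, 𝓕)^G`: the homomorphisms of sheaves that commute with the action of `G`, where `𝓔` and
`𝓕` are the direct sums of the equivariant line bundles given by `r` and by `r'`. -/
def equivariantHom : Submodule ℂ (sheafHom r r') where
  carrier := {φ | ∀ (ζ : MuCubed d) (V : Opens P2) (s : sections r V),
    φ.1 (preOpen ζ V) (pullback ζ s) = pullback ζ (φ.1 V s)}
  add_mem' := by
    intro φ ψ h1 h2 ζ V s
    have h : (φ + ψ).1 = φ.1 + ψ.1 := rfl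
    simp only [h, Pi.add_apply, LinearMap.add_apply, h1 ζ V s, h2 ζ V s]
    ext i u
    simp [pullback, mul_add]
  zero_mem' := by
    intro ζ V s
    ext i u
    simp [pullback]
  smul_mem' := by
    intro c φ h1 ζ V s
    have h : (c • φ).1 = c • φ.1 := rfl
    simp only [h, Pi.smul_apply, LinearMap.smul_apply, h1 ζ V s]
    ext i u
    simp [pullback, mul_left_comm]

/-- The diagonal of `μ_d³` acts trivially on the plane. -/
theorem scale_diagonal (η : rootsOfUnity d ℂ) (P : P2) :
    scale (fun _ => η : MuCubed d) P = P := by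
  induction P using P2.ind with
  | h u hu =>
    exact (Projectivization.mk_eq_mk_iff' ℂ _ _ _ _).mpr ⟨((η : ℂˣ) : ℂ), rfl⟩

/-- The diagonal of `μ_d³` acts trivially on sections. -/
theorem pullback_diagonal (η : rootsOfUnity d ℂ) {V : Opens P2} (s : sections r V) (i : ι)
    (u : Fin 3 → ℂ) (hu : u ∈ cone V) (hu' : u ∈ cone (preOpen (fun _ => η : MuCubed d) V)) :
    (pullback (fun _ => η : MuCubed d) s).1 i ⟨u, hu'⟩ = s.1 i ⟨u, hu⟩ := by
  have h := (s.2 i).smul_apply ⟨u, hu⟩ ⟨_, scaleVec_mem_cone _ hu'⟩ ((η : ℂˣ) : ℂ)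
    (Units.ne_zero _) rfl
  have hw : weight (fun _ => η : MuCubed d) (r i) = ((η : ℂˣ) : ℂ) ^ (∑ k, r i k) := by
    simp [weight, MuCubed.coord, Fin.sum_univ_three, Fin.prod_univ_three, zpow_add₀]
  change (weight (fun _ => η : MuCubed d) (r i))⁻¹ * _ = _
  rw [h, hw, inv_mul_cancel_left₀ (zpow_ne_zero _ (Units.ne_zero _))]

end Action

/-! ### The bundles `𝓔`, `𝓕` and the extension of the Kasteleyn matrix -/

/-- `𝓔_b = 𝒪^G(𝐝(b) - D)` with `D = D₀ + D₁ + D₂`; `𝓔` is the direct sum over all `b`. -/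
def divisorE (b : Black d) : Fin 3 → ℤ :=
  abelBlack b - (coordDivisor 0 + coordDivisor 1 + coordDivisor 2)

/-- `𝓕_w = 𝒪^G(𝐝(w))`; `𝓕` is the direct sum over all `w`. -/
def divisorF (w : White d) : Fin 3 → ℤ := abelWhite w

/-- The value at `u`, with nonzero coordinates, of the `G`-invariant section
`x₀^{r₀} x₁^{r₁} x₂^{r₂}` that trivializes `𝒪^G(r₀ D₀ + r₁ D₁ + r₂ D₂)` over the torus. -/
noncomputable def torusFrame (r : Fin 3 → ℤ) (u : Fin 3 → ℂ) : ℂ := ∏ k, u k ^ r k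

/-- The sheaf homomorphism `φ : 𝓔 → 𝓕` extends the Kasteleyn matrix `K(x)`: over the torus, in the
trivializations given by the frames, `φ` is the matrix `K(x)(z, w)` with
`(z, w) = ((u₁/u₀)^d, (u₂/u₀)^d)`, the pullback of the coordinates of the torus under
`[u₀ : u₁ : u₂] ↦ [u₀^d : u₁^d : u₂^d]`. -/
def ExtendsKasteleyn [NeZero d] (x : Edge d → ℂ)
    (φ : sheafHom (divisorE (d := d)) (divisorF (d := d))) : Prop :=
  ∀ (V : Opens P2) (s : sections (divisorE (d := d)) V) (u : cone V), (∀ k, u.1 k ≠ 0) →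
    ∀ v : White d, (φ.1 V s).1 v u / torusFrame (divisorF v) u.1 =
      ∑ b : Black d, kasteleyn x ((u.1 1 / u.1 0) ^ d) ((u.1 2 / u.1 0) ^ d) v b *
        (s.1 b u / torusFrame (divisorE b) u.1)

end DimerP2

/-!
The degrees of the summands of `𝓔` are `-1` and those of `𝓕` are `0`, so a homomorphism `𝓔 → 𝓕` is a
matrix of global sections of `𝒪(1)`, that is, of linear forms `∑ c_k x_k`. Such a matrix is invariant
under `G` exactly when `x_k` occurs in the entry `(w, b)` only if the characters of `x_k` and of
`x^{𝐝(w) - (𝐝(b) - D)}` agree, i.e. if `𝐝(w)` and `𝐝(b) - D + D_k` are congruent modulo `d`. The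
discrete Abel map is made so that this happens precisely when the edge of type `k` at `w` ends in
`b`. Thus the coefficients of an invariant matrix are the same thing as a function on the edges.
The congruence is an equality up to `d (D₁ - D₀)` for edges crossing one side of the fundamental
domain and `d (D₂ - D₀)` for those crossing the other, and in the trivializations over the torus
these multiples turn into the factors `z` and `w` of the Kasteleyn matrix
(`divisorE_black_add`, `coord_mul_torusFrame`).

Three facts about sections on the plane are needed. Sections that agree on the torus are equal, as
the torus is dense (`IsSection.eq_of_torus`); this gives the uniqueness of extensions. A global
section is a polynomial function (`IsSection.exists_polynomial`): write it as a reduced fraction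
near one point; its denominator divides the denominator of every other local representation, so
it has no zeros away from the origin, and it is constant by the Nullstellensatz. Finally, a
homomorphism between direct sums of line bundles is a matrix of global sections
(`sheafHom_exists_matrix`): over the charts `x_k ≠ 0` the bundles are free, and the matrices found
there agree on overlaps. The resulting parametrization is `equivariantHomEquiv`, applied to all of
`𝓔 → 𝓕` for the isomorphism and to single summands for the dimensions.
-/

namespace DimerP2

open TopologicalSpace (Opens)
open MvPolynomial

/-! ### Polynomials, sections and the Zariski topology -/

/-- Every point of an open set has a principal neighbourhood in it. The polynomial `h` need not be
homogeneous for the applications. -/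
theorem exists_basicOpen_subset {V : Opens P2} {u : Fin 3 → ℂ} (hu : u ∈ cone V) :
    ∃ h : MvPolynomial (Fin 3) ℂ, eval u h ≠ 0 ∧ ∀ v, v ≠ 0 → eval v h ≠ 0 → v ∈ cone V := by
  obtain ⟨V, hV⟩ := V
  induction hV generalizing u with
  | basic V hV =>
    obtain ⟨n, p, hp, rfl⟩ := hV
    obtain ⟨hu0, hu⟩ := hu
    exact ⟨p, (mk_mem_basicOpen hp u hu0).mp hu,
      fun v hv0 hv => ⟨hv0, (mk_mem_basicOpen hp v hv0).mpr hv⟩⟩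
  | univ => exact ⟨1, by simp, fun v hv _ => ⟨hv, trivial⟩⟩
  | inter V W hV hW ihV ihW =>
    obtain ⟨hu0, huV, huW⟩ := hu
    obtain ⟨h, h1, h2⟩ := ihV ⟨hu0, huV⟩
    obtain ⟨h', h1', h2'⟩ := ihW ⟨hu0, huW⟩
    refine ⟨h * h', by simp [h1, h1'], fun v hv0 hv => ?_⟩
    rw [map_mul] at hv
    exact ⟨hv0, (h2 v hv0 (left_ne_zero_of_mul hv)).2, (h2' v hv0 (right_ne_zero_of_mul hv)).2⟩
  | sUnion S hS ih =>
    obtain ⟨hu0, V, hVS, huV⟩ := hu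
    obtain ⟨h, h1, h2⟩ := ih V hVS ⟨hu0, huV⟩
    exact ⟨h, h1, fun v hv0 hv => ⟨hv0, V, hVS, (h2 v hv0 hv).2⟩⟩

/-- The torus is dense: a section that vanishes at its points is zero. -/
theorem IsSection.eq_zero_of_torus {n : ℤ} {V : Opens P2} {s : cone V → ℂ} (hs : IsSection n V s)
    (h0 : ∀ u : cone V, (∀ k, u.1 k ≠ 0) → s u = 0) : s = 0 := by
  funext u
  obtain ⟨k, l, p, q, -, -, -, hu, h⟩ := hs u
  obtain ⟨f, hf, hfV⟩ := exists_basicOpen_subset u.2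
  -- Off the torus or outside the neighbourhood of `u`, one of the other factors vanishes.
  have key : p * (q * f * (X 0 * X 1 * X 2)) = 0 := by
    refine MvPolynomial.funext fun v => ?_
    by_contra hv
    simp only [map_mul, map_zero, eval_X, mul_eq_zero, not_or] at hv
    obtain ⟨hvp, ⟨hvq, hvf⟩, ⟨hv0, hv1⟩, hv2⟩ := hv
    have hvV := hfV v (fun h => hv0 (by simp [h])) hvf
    have hz := h0 ⟨v, hvV⟩ (fun k => by fin_cases k <;> assumption)
    rw [h ⟨v, hvV⟩ hvq] at hz
    exact (div_ne_zero hvp hvq) hz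
  have hq : q ≠ 0 := fun hq => hu (by simp [hq])
  have hf0 : f ≠ 0 := fun hq => hf (by simp [hq])
  have hp : p = 0 := by simpa [hq, hf0, X_ne_zero] using key
  simp [h u hu, hp]

theorem IsSection.eq_of_torus {n : ℤ} {V : Opens P2} {s t : cone V → ℂ} (hs : IsSection n V s)
    (ht : IsSection n V t) (h : ∀ u : cone V, (∀ k, u.1 k ≠ 0) → s u = t u) : s = t := by
  have h' := (hs.add (ht.const_mul (-1))).eq_zero_of_torus fun u hu => by simp [h u hu]
  funext u
  have := congrFun h' u
  simp only [Pi.add_apply, Pi.smul_apply, smul_eq_mul, Pi.zero_apply] at this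
  linear_combination this

theorem IsSection.sum {ι : Type*} {n : ℤ} {V : Opens P2} (A : Finset ι) {s : ι → cone V → ℂ}
    (hs : ∀ i ∈ A, IsSection n V (s i)) : IsSection n V (∑ i ∈ A, s i) :=
  Finset.sum_induction s (IsSection n V) (fun _ _ => IsSection.add) (isSection_zero n V) hs

/-- The affine chart `x_k ≠ 0`. -/
noncomputable def coordOpen (k : Fin 3) : Opens P2 :=
  ⟨basicOpen (X k), TopologicalSpace.isOpen_generateFrom_of_mem ⟨1, X k, isHomogeneous_X _ k, rfl⟩⟩

theorem mem_cone_coordOpen {k : Fin 3} {u : Fin 3 → ℂ} : u ∈ cone (coordOpen k) ↔ u k ≠ 0 := by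
  refine ⟨fun ⟨hu, h⟩ => ?_, fun h => ?_⟩
  · simpa using (mk_mem_basicOpen (isHomogeneous_X ℂ k) u hu).mp h
  · have hu : u ≠ 0 := fun h0 => h (by simp [h0])
    exact ⟨hu, (mk_mem_basicOpen (isHomogeneous_X ℂ k) u hu).mpr (by simpa using h)⟩

theorem single_mem_cone_coordOpen (k : Fin 3) :
    (Pi.single k 1 : Fin 3 → ℂ) ∈ cone (coordOpen k) := by
  simp [mem_cone_coordOpen]

theorem isSection_coord_zpow {k : Fin 3} {V : Opens P2} (hV : V ≤ coordOpen k) (n : ℤ) :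
    IsSection n V (fun u => u.1 k ^ n) := by
  intro u
  have hk (v : cone V) : v.1 k ≠ 0 := mem_cone_coordOpen.mp (cone_mono hV v.2)
  refine ⟨n.toNat, (-n).toNat, X k ^ n.toNat, X k ^ (-n).toNat, isHomogeneous_X_pow _ _,
    isHomogeneous_X_pow _ _, by omega, by simp [hk], fun v _ => ?_⟩
  simp only [map_pow, eval_X]
  rw [← zpow_natCast, ← zpow_natCast, ← zpow_sub₀ (hk v)]
  congr 1
  omega

theorem isSection_linear (V : Opens P2) (c : Fin 3 → ℂ) :
    IsSection 1 V (fun u => ∑ k, c k * u.1 k) := fun _ =>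
  ⟨1, 0, ∑ k, C (c k) * X k, 1,
    IsHomogeneous.sum _ _ _ fun k _ => isHomogeneous_C_mul_X _ k, isHomogeneous_one _ _,
    by simp, by simp, fun v _ => by simp⟩

/-- Being a section is local, for the cover of the plane by the affine charts. -/
theorem isSection_top_of_coordOpen {n : ℤ} {s : cone ⊤ → ℂ}
    (h : ∀ k, IsSection n (coordOpen k) (fun u => s ⟨u.1, cone_mono le_top u.2⟩)) :
    IsSection n ⊤ s := by
  intro u
  obtain ⟨i, hi⟩ : ∃ i, u.1 i ≠ 0 := Function.ne_iff.mp u.2.1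
  obtain ⟨k, l, p, q, hp, hq, hkl, hu, hv⟩ := h i ⟨u.1, mem_cone_coordOpen.mpr hi⟩
  refine ⟨k + 1, l + 1, p * X i, q * X i, hp.mul (isHomogeneous_X _ i), hq.mul (isHomogeneous_X _ i),
    by push_cast; omega, by simpa using ⟨hu, hi⟩, fun v hvq => ?_⟩
  simp only [map_mul, eval_X] at hvq ⊢
  rw [mul_div_mul_right _ _ (right_ne_zero_of_mul hvq)]
  exact hv ⟨v.1, mem_cone_coordOpen.mpr (right_ne_zero_of_mul hvq)⟩ (left_ne_zero_of_mul hvq)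

/-- A polynomial without zeros outside the origin is a unit: by the Nullstellensatz it divides
powers of two different coordinates. -/
theorem isUnit_of_eval_ne_zero {q : MvPolynomial (Fin 3) ℂ}
    (h : ∀ u : Fin 3 → ℂ, u ≠ 0 → eval u q ≠ 0) : IsUnit q := by
  have hX (k : Fin 3) : ∃ n, q ∣ X k ^ n := by
    have : (X k : MvPolynomial (Fin 3) ℂ) ∈ (Ideal.span {q}).radical := by
      rw [← vanishingIdeal_zeroLocus_eq_radical (K := ℂ), mem_vanishingIdeal_iff]
      intro u hu
      have hq := (mem_zeroLocus_iff.mp hu) q (Ideal.mem_span_singleton_self q)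
      have hu0 : u = 0 := by
        by_contra hu0
        exact h u hu0 (by simpa [aeval_eq_eval] using hq)
      simp [hu0]
    obtain ⟨n, hn⟩ := this
    exact ⟨n, Ideal.mem_span_singleton.mp hn⟩
  obtain ⟨m, hm⟩ := hX 0
  obtain ⟨n, hn⟩ := hX 1
  obtain ⟨i, -, hi⟩ := (dvd_prime_pow (X_prime (R := ℂ) (i := (0 : Fin 3))) m).mp hm
  rcases Nat.eq_zero_or_pos i with rfl | hi0
  · exact associated_one_iff_isUnit.mp (by simpa using hi)
  · have h01 : (X 0 : MvPolynomial (Fin 3) ℂ) ∣ X 1 :=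
      (X_prime (R := ℂ) (i := (0 : Fin 3))).dvd_of_dvd_pow
        ((dvd_pow_self _ hi0.ne').trans (hi.symm.dvd.trans hn))
    simp [X_dvd_X] at h01

/-- A global section is a polynomial function: the denominator of a reduced fraction representing
it divides all the denominators that occur, so it vanishes nowhere. -/
theorem IsSection.exists_polynomial {n : ℤ} {s : cone ⊤ → ℂ} (hs : IsSection n ⊤ s) :
    ∃ P : MvPolynomial (Fin 3) ℂ, ∀ u, s u = eval u.1 P := by
  have hone : (fun _ => 1 : Fin 3 → ℂ) ∈ cone ⊤ := ⟨fun h => by simpa using congrFun h 0, trivial⟩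
  obtain ⟨-, -, p, q, -, -, -, hq1, hpq⟩ := hs ⟨_, hone⟩
  have hq : q ≠ 0 := fun h => hq1 (by simp [h])
  obtain ⟨p', q', g, hrel, rfl, rfl⟩ := UniqueFactorizationMonoid.exists_reduced_factors' p q hq
  have hg : g ≠ 0 := left_ne_zero_of_mul hq
  have hq' : q' ≠ 0 := right_ne_zero_of_mul hq
  have key (u : cone (⊤ : Opens P2)) : ∃ a b : MvPolynomial (Fin 3) ℂ, eval u.1 b ≠ 0 ∧
      s u = eval u.1 a / eval u.1 b ∧ p' * b = q' * a := by
    obtain ⟨-, -, a, b, -, -, -, hb, hab⟩ := hs u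
    refine ⟨a, b, hb, hab u hb, ?_⟩
    have hb0 : b ≠ 0 := fun h => hb (by simp [h])
    -- The two fractions agree where both denominators are nonzero.
    have : (p' * b - q' * a) * (g * q' * b * X 0) = 0 := by
      refine MvPolynomial.funext fun v => ?_
      by_contra hv
      simp only [map_mul, map_zero, map_sub, eval_X, mul_eq_zero, not_or] at hv
      obtain ⟨hv1, ⟨⟨hvg, hvq⟩, hvb⟩, hv0⟩ := hv
      have hvc : v ∈ cone (⊤ : Opens P2) := ⟨fun h => hv0 (by simp [h]), trivial⟩
      have e1 := hpq ⟨v, hvc⟩ (by simpa using ⟨hvg, hvq⟩)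
      rw [hab ⟨v, hvc⟩ hvb] at e1
      simp only [map_mul] at e1
      rw [mul_div_mul_left _ _ hvg, div_eq_div_iff hvb hvq] at e1
      exact hv1 (by linear_combination -e1)
    have h4 : g * q' * b * X 0 ≠ 0 :=
      mul_ne_zero (mul_ne_zero (mul_ne_zero hg hq') hb0) (X_ne_zero 0)
    exact sub_eq_zero.mp ((mul_eq_zero.mp this).resolve_right h4)
  have hunit : IsUnit q' := by
    refine isUnit_of_eval_ne_zero fun u hu h0 => ?_
    obtain ⟨a, b, hb, -, hab⟩ := key ⟨u, hu, trivial⟩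
    have hdvd : q' ∣ b := hrel.symm.dvd_of_dvd_mul_left ⟨a, hab⟩
    exact hb (by obtain ⟨c, rfl⟩ := hdvd; simp [h0])
  obtain ⟨q'', hq''⟩ := hunit.exists_right_inv
  refine ⟨p' * q'', fun u => ?_⟩
  obtain ⟨a, b, hb, hsu, hab⟩ := key u
  have : p' * q'' * b = a := by linear_combination q'' * hab + a * hq''
  rw [hsu, ← this, map_mul _ _ b, mul_div_cancel_right₀ _ hb]

theorem coeff_bind₁_C_mul_X (a : ℂ) (P : MvPolynomial (Fin 3) ℂ) (m : Fin 3 →₀ ℕ) :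
    coeff m (bind₁ (fun k => C a * X k) P) = a ^ m.degree * coeff m P := by
  induction P using MvPolynomial.induction_on' with
  | monomial n c =>
    have : bind₁ (fun k => C a * X k) (monomial n c) = C (a ^ n.degree) * monomial n c := by
      rw [bind₁_monomial, monomial_eq (a := c)]
      simp only [mul_pow, Finset.prod_mul_distrib, Finsupp.prod, Finsupp.degree_apply,
        Finset.prod_pow_eq_pow_sum, C_pow]
      ring
    rw [this, coeff_C_mul, coeff_monomial]
    split_ifs with h
    · rw [h]
    · simp
  | add p q hp hq => rw [map_add, coeff_add, coeff_add, hp, hq, mul_add]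

/-- The global sections of `𝒪(1)` are the linear forms. -/
theorem IsSection.exists_linear {s : cone ⊤ → ℂ} (hs : IsSection 1 ⊤ s) :
    ∃ c : Fin 3 → ℂ, ∀ u, s u = ∑ k, c k * u.1 k := by
  obtain ⟨P, hP⟩ := hs.exists_polynomial
  have hscale : bind₁ (fun k => C 2 * X k) P = C 2 * P := by
    -- Both sides agree away from the origin, hence everywhere.
    refine mul_right_cancel₀ (X_ne_zero (R := ℂ) (0 : Fin 3)) (MvPolynomial.funext fun u => ?_)
    by_cases hu : u 0 = 0
    · simp [hu]
    · have hu0 : u ≠ 0 := fun h => hu (by simp [h])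
      have h2 : (2 : ℂ) • u ≠ 0 := smul_ne_zero two_ne_zero hu0
      have := hs.smul_apply ⟨u, hu0, trivial⟩ ⟨_, h2, trivial⟩ 2 two_ne_zero rfl
      rw [hP, hP, zpow_one] at this
      simp only [map_mul, eval_X, eval_C]
      rw [← this, ← aeval_eq_eval, ← aeval_eq_eval, aeval_bind₁]
      simp [Pi.smul_def]
  -- Comparing coefficients, only monomials with `2 ^ deg = 2` occur.
  have hdeg (m : Fin 3 →₀ ℕ) (hm : coeff m P ≠ 0) : ∃ k, Finsupp.single k 1 = m := by
    have h := coeff_bind₁_C_mul_X 2 P m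
    rw [hscale, coeff_C_mul] at h
    have h' : (2 : ℂ) ^ m.degree = 2 ^ 1 := by simpa using (mul_right_cancel₀ hm h).symm
    have h1 : m.degree = 1 := Nat.pow_right_injective le_rfl (by exact_mod_cast h')
    rw [Finsupp.degree_eq_sum, Fin.sum_univ_three] at h1
    obtain h | h | h : m 0 = 1 ∨ m 1 = 1 ∨ m 2 = 1 := by omega
    exacts [⟨0, by ext l; fin_cases l <;> simp <;> omega⟩,
      ⟨1, by ext l; fin_cases l <;> simp <;> omega⟩, ⟨2, by ext l; fin_cases l <;> simp <;> omega⟩]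
  refine ⟨fun k => coeff (Finsupp.single k 1) P, fun u => ?_⟩
  have : P = ∑ k, C (coeff (Finsupp.single k 1) P) * X k := by
    ext m
    simp only [coeff_sum, coeff_C_mul, coeff_X]
    by_cases hm : ∃ k, Finsupp.single k 1 = m
    · obtain ⟨k, rfl⟩ := hm
      rw [Finset.sum_eq_single k] <;> simp +contextual [Finsupp.single_left_inj]
    · rw [Finset.sum_eq_zero fun k _ => by rw [if_neg fun h => hm ⟨k, h⟩, mul_zero]]
      by_contra h
      exact hm (hdeg m h)
  rw [hP]
  conv_lhs => rw [this]
  simp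

/-! ### Homomorphisms as matrices of global sections -/

section Sheaf

variable {ι κ : Type} {r : ι → Fin 3 → ℤ} {r' : κ → Fin 3 → ℤ}

/-- The section of the direct sum over a chart `x_k ≠ 0` that is a power of `x_k` in the summand
`i` and zero in the others. -/
noncomputable def chartFrame [DecidableEq ι] (r : ι → Fin 3 → ℤ) (k : Fin 3) (i : ι) {V : Opens P2}
    (hV : V ≤ coordOpen k) : sections r V :=
  ⟨fun j u => if j = i then u.1 k ^ ∑ l, r j l else 0, fun j => by
    by_cases h : j = i <;> simp only [h, if_true, if_false]
    · exact isSection_coord_zpow hV _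
    · exact isSection_zero _ _⟩

/-- Over a chart a homomorphism is determined by the images of the frame. -/
theorem sheafHom_apply_of_le [Fintype ι] [DecidableEq ι] (φ : sheafHom r r') {k : Fin 3}
    {V : Opens P2} (hV : V ≤ coordOpen k) (s : sections r V) (j : κ) (u : cone V) :
    (φ.1 V s).1 j u =
      ∑ i, s.1 i u / u.1 k ^ (∑ l, r i l) * (φ.1 V (chartFrame r k i hV)).1 j u := by
  have hk (v : cone V) : v.1 k ≠ 0 := mem_cone_coordOpen.mp (cone_mono hV v.2)
  have hf (i : ι) : IsSection 0 V (s.1 i * fun u => u.1 k ^ (-∑ l, r i l)) := by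
    simpa using (s.2 i).mul (isSection_coord_zpow hV (-∑ l, r i l))
  have hs : s = ∑ i, mulSection _ (hf i) (chartFrame r k i hV) := by
    ext j v
    rw [AddSubmonoidClass.coe_finsetSum, Finset.sum_apply, Finset.sum_apply,
      Finset.sum_eq_single j]
    · simp [mulSection, chartFrame, zpow_neg, hk v, zpow_ne_zero]
    · intro i _ hi
      simp [mulSection, chartFrame, hi.symm]
    · simp
  conv_lhs => rw [hs]
  rw [map_sum, AddSubmonoidClass.coe_finsetSum, Finset.sum_apply, Finset.sum_apply]
  refine Finset.sum_congr rfl fun i _ => ?_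
  rw [φ.2.1]
  simp [mulSection, zpow_neg, div_eq_mul_inv]

/-- A homomorphism between direct sums of line bundles is a matrix of global sections: over the
chart `x_k ≠ 0` the matrix consists of the quotients of the images of the frame by powers of `x_k`,
and these matrices agree on the overlaps of the charts. -/
theorem sheafHom_exists_matrix [Fintype ι] (φ : sheafHom r r') :
    ∃ m : κ → ι → cone ⊤ → ℂ, (∀ j i, IsSection (∑ l, r' j l - ∑ l, r i l) ⊤ (m j i)) ∧
      ∀ (V : Opens P2) (s : sections r V) (j : κ) (u : cone V),
        (φ.1 V s).1 j u = ∑ i, m j i ⟨u.1, cone_mono le_top u.2⟩ * s.1 i u := by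
  classical
  choose idx hidx using fun u : cone (⊤ : Opens P2) => Function.ne_iff.mp u.2.1
  let loc (k : Fin 3) (j : κ) (i : ι) (u : cone (coordOpen k)) : ℂ :=
    (φ.1 (coordOpen k) (chartFrame r k i le_rfl)).1 j u / u.1 k ^ ∑ l, r i l
  let m (j : κ) (i : ι) (u : cone (⊤ : Opens P2)) : ℂ :=
    loc (idx u) j i ⟨u.1, mem_cone_coordOpen.mpr (hidx u)⟩
  -- On an overlap, expand the restriction of the frame of one chart in the frame of the other.
  have hloc (k l : Fin 3) (j : κ) (i : ι) (u : Fin 3 → ℂ) (hk : u ∈ cone (coordOpen k))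
      (hl : u ∈ cone (coordOpen l)) : loc k j i ⟨u, hk⟩ = loc l j i ⟨u, hl⟩ := by
    let V := coordOpen k ⊓ coordOpen l
    have hu : u ∈ cone V := ⟨hk.1, hk.2, hl.2⟩
    have e1 := congrArg (fun t : sections r' V => t.1 j ⟨u, hu⟩)
      (φ.2.2 V (coordOpen k) inf_le_left (chartFrame r k i le_rfl))
    have e2 := congrArg (fun t : sections r' V => t.1 j ⟨u, hu⟩)
      (φ.2.2 V (coordOpen l) inf_le_right (chartFrame r l i le_rfl))
    have hl0 := mem_cone_coordOpen.mp hl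
    have hk0 := mem_cone_coordOpen.mp hk
    have e3 := sheafHom_apply_of_le φ (k := l) inf_le_right
      (restrict inf_le_left (chartFrame r k i le_rfl) : sections r V) j ⟨u, hu⟩
    rw [Finset.sum_eq_single i _ (by simp)] at e3
    · change (φ.1 V (chartFrame r l i inf_le_right)).1 j ⟨u, hu⟩ = _ at e2
      rw [e2] at e3
      replace e3 := e1.symm.trans e3
      simp only [restrict, chartFrame, if_true] at e3
      simp only [loc, chartFrame]
      rw [e3]
      have := zpow_ne_zero (∑ l, r i l) hl0
      have := zpow_ne_zero (∑ l, r i l) hk0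
      field_simp
    · intro i' _ hi'
      simp [restrict, chartFrame, hi']
  refine ⟨m, fun j i => isSection_top_of_coordOpen fun k => ?_, fun V s j u => ?_⟩
  · have h := ((φ.1 (coordOpen k) (chartFrame r k i le_rfl)).2 j).mul
      (isSection_coord_zpow (le_refl (coordOpen k)) (-∑ l, r i l))
    rw [sub_eq_add_neg]
    convert h using 1
    funext u
    simp only [Pi.mul_apply, zpow_neg, ← div_eq_mul_inv]
    exact hloc _ _ j i u.1 _ u.2
  · obtain ⟨k, hk⟩ : ∃ k, u.1 k ≠ 0 := Function.ne_iff.mp u.2.1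
    have hu : u.1 ∈ cone (V ⊓ coordOpen k) := ⟨u.2.1, u.2.2, (mem_cone_coordOpen.mpr hk).2⟩
    have e1 := congrArg (fun t : sections r' _ => t.1 j ⟨u.1, hu⟩)
      (φ.2.2 (V ⊓ coordOpen k) V inf_le_left s)
    refine e1.symm.trans ((sheafHom_apply_of_le φ inf_le_right _ j _).trans ?_)
    refine Finset.sum_congr rfl fun i _ => ?_
    have e2 := congrArg (fun t : sections r' _ => t.1 j ⟨u.1, hu⟩)
      (φ.2.2 (V ⊓ coordOpen k) (coordOpen k) inf_le_right (chartFrame r k i le_rfl))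
    have e3 : m j i ⟨u.1, cone_mono le_top u.2⟩ = loc k j i ⟨u.1, mem_cone_coordOpen.mpr hk⟩ :=
      hloc _ _ _ _ _ _ _
    change (φ.1 (V ⊓ coordOpen k) (chartFrame r k i inf_le_right)).1 j ⟨u.1, hu⟩ = _ at e2
    rw [e2, e3, div_mul_eq_mul_div, mul_comm (_ / _), ← mul_div_assoc]
    rfl

end Sheaf

/-! ### Homomorphisms given by matrices of linear forms -/

section Matrix

variable {ι κ : Type} {r : ι → Fin 3 → ℤ} {r' : κ → Fin 3 → ℤ}

/-- The exponents of `x^{r'_j - r_i}` and of `x_k` agree modulo `d`, where `t = (j, i, k)`; that is,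
multiplication by `x_k` is a `G`-invariant map between the line bundles given by `r i` and `r' j`. -/
def HasInvariantWeight (d : ℕ) (r : ι → Fin 3 → ℤ) (r' : κ → Fin 3 → ℤ) (t : κ × ι × Fin 3) :
    Prop :=
  ∀ l, (d : ℤ) ∣ r' t.1 l - (r t.2.1 l + coordDivisor t.2.2 l)

theorem weight_add_coordDivisor {d : ℕ} (ζ : MuCubed d) (a : Fin 3 → ℤ) (k : Fin 3) :
    weight ζ (a + coordDivisor k) = weight ζ a * MuCubed.coord ζ k := by
  have h : ∏ l, MuCubed.coord ζ l ^ (coordDivisor k l) = MuCubed.coord ζ k := by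
    rw [Finset.prod_eq_single k]
    · simp [coordDivisor]
    · intro l _ hl
      simp [coordDivisor, hl]
    · simp
  simp only [weight, Pi.add_apply, zpow_add₀ (MuCubed.coord_ne_zero ζ _), Finset.prod_mul_distrib, h]

/-- Characters of `μ_d³` are determined by their exponents modulo `d`. -/
theorem weight_eq_weight_iff {d : ℕ} [NeZero d] (a b : Fin 3 → ℤ) :
    (∀ ζ : MuCubed d, weight ζ a = weight ζ b) ↔ ∀ l, (d : ℤ) ∣ a l - b l := by
  refine ⟨fun h l => ?_, fun h ζ => Finset.prod_congr rfl fun l _ => ?_⟩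
  -- Evaluate at a primitive root of unity in one place and `1` in the others.
  · have hη := Complex.isPrimitiveRoot_exp d (NeZero.ne d)
    have hw (a : Fin 3 → ℤ) : weight (Pi.mulSingle l hη.toRootsOfUnity : MuCubed d) a =
        Complex.exp (2 * Real.pi * Complex.I / d) ^ a l := by
      rw [weight, Finset.prod_eq_single l]
      · simp [MuCubed.coord]
      · intro l' _ hl
        simp [MuCubed.coord, Pi.mulSingle_eq_of_ne hl]
      · simp
    have := h (Pi.mulSingle l hη.toRootsOfUnity)
    rw [hw, hw] at this
    rw [← hη.zpow_eq_one_iff_dvd, zpow_sub₀ (Complex.exp_ne_zero _), this,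
      div_self (zpow_ne_zero _ (Complex.exp_ne_zero _))]
  · obtain ⟨m, hm⟩ := h l
    have hd : MuCubed.coord ζ l ^ (d : ℤ) = 1 := by
      have := (mem_rootsOfUnity' d _).mp (ζ l).2
      exact_mod_cast this
    rw [show a l = d * m + b l by omega, zpow_add₀ (MuCubed.coord_ne_zero ζ l), zpow_mul, hd,
      one_zpow, one_mul]

theorem hasInvariantWeight_iff {d : ℕ} [NeZero d] {j : κ} {i : ι} {k : Fin 3} :
    HasInvariantWeight d r r' (j, i, k) ↔
      ∀ ζ : MuCubed d, weight ζ (r' j) = weight ζ (r i) * MuCubed.coord ζ k := by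
  simp only [← weight_add_coordDivisor, weight_eq_weight_iff]
  rfl

theorem weight_ne_zero {d : ℕ} (ζ : MuCubed d) (a : Fin 3 → ℤ) : weight ζ a ≠ 0 :=
  Finset.prod_ne_zero_iff.mpr fun _ _ => zpow_ne_zero _ (MuCubed.coord_ne_zero ζ _)

variable [Fintype ι]

/-- The homomorphism given by the matrix of linear forms whose entry at `(j, i)` has the coefficients
`c (j, i, k)`, between direct sums of line bundles whose degrees differ by one. -/
noncomputable def linearFormHom (hr : ∀ j i, ∑ l, r' j l = 1 + ∑ l, r i l) :
    (κ × ι × Fin 3 → ℂ) →ₗ[ℂ] sheafHom r r' where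
  toFun c := ⟨fun V =>
    { toFun := fun s => ⟨fun j u => ∑ i, (∑ k, c (j, i, k) * u.1 k) * s.1 i u, fun j => by
        have h := IsSection.sum Finset.univ (n := ∑ l, r' j l) fun i _ => by
          have := (isSection_linear V fun k => c (j, i, k)).mul (s.2 i)
          rwa [← hr j i] at this
        convert h using 1
        funext u
        simp⟩
      map_add' := fun s t => by
        ext j u
        simp [mul_add, Finset.sum_add_distrib]
      map_smul' := fun a s => by
        ext j u
        simp [Finset.mul_sum, mul_left_comm] },
    fun V f hf s => by
      ext j u
      simp [mulSection, Finset.mul_sum, mul_left_comm],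
    fun V W h s => rfl⟩
  map_add' c c' := by
    ext V s j u
    simp [add_mul, Finset.sum_add_distrib]
  map_smul' a c := by
    ext V s j u
    simp [Finset.mul_sum, Finset.sum_mul, mul_assoc]

variable (hr : ∀ j i, ∑ l, r' j l = 1 + ∑ l, r i l)

theorem linearFormHom_apply (c : κ × ι × Fin 3 → ℂ) (V : Opens P2) (s : sections r V) (j : κ)
    (u : cone V) : ((linearFormHom hr c).1 V s).1 j u =
      ∑ i, (∑ k, c (j, i, k) * u.1 k) * s.1 i u := rfl

theorem linearFormHom_surjective : Function.Surjective (linearFormHom hr) := by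
  intro φ
  obtain ⟨m, hm, hφ⟩ := sheafHom_exists_matrix φ
  have hm' (j : κ) (i : ι) : IsSection 1 ⊤ (m j i) := by
    have := hm j i
    rwa [hr j i, add_sub_cancel_right] at this
  choose c hc using fun j i => (hm' j i).exists_linear
  refine ⟨fun t => c t.1 t.2.1 t.2.2, ?_⟩
  ext V s j u
  rw [linearFormHom_apply, hφ]
  simp only [hc]

theorem linearFormHom_chartFrame [DecidableEq ι] (c : κ × ι × Fin 3 → ℂ) {V : Opens P2}
    {k : Fin 3} (hV : V ≤ coordOpen k) (i : ι) (j : κ) (u : cone V) :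
    ((linearFormHom hr c).1 V (chartFrame r k i hV)).1 j u =
      (∑ l, c (j, i, l) * u.1 l) * u.1 k ^ ∑ l, r i l := by
  rw [linearFormHom_apply, Finset.sum_eq_single i]
  · simp [chartFrame]
  · intro i' _ hi'
    simp [chartFrame, hi']
  · simp

theorem linearFormHom_injective : Function.Injective (linearFormHom hr) := by
  classical
  rw [injective_iff_map_eq_zero]
  intro c hc
  funext ⟨j, i, k⟩
  have h := linearFormHom_chartFrame hr c (le_refl (coordOpen k)) i j
    ⟨_, single_mem_cone_coordOpen k⟩
  rw [hc] at h
  simpa [Pi.single_apply] using h.symm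

theorem linearFormHom_mem_equivariantHom_iff {d : ℕ} [NeZero d] (c : κ × ι × Fin 3 → ℂ) :
    linearFormHom hr c ∈ equivariantHom d r r' ↔ ∀ t, c t ≠ 0 → HasInvariantWeight d r r' t := by
  classical
  refine ⟨?_, fun h ζ V s => ?_⟩
  · rintro h ⟨j, i, k⟩ hc
    refine hasInvariantWeight_iff.mpr fun ζ => ?_
    -- Compare both sides on the frame of the chart `x_k ≠ 0`, at the coordinate vector `e_k`.
    have hu : scaleVec ζ (Pi.single k 1) k ≠ 0 := by simp [scaleVec, MuCubed.coord_ne_zero]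
    have hmem : (Pi.single k 1 : Fin 3 → ℂ) ∈ cone (preOpen ζ (coordOpen k)) := by
      have h0 : (Pi.single k 1 : Fin 3 → ℂ) ≠ 0 := by simp
      exact ⟨h0, (mem_cone_coordOpen.mpr hu).2⟩
    have e := congrArg (fun t : sections r' _ => t.1 j ⟨_, hmem⟩)
      (h ζ (coordOpen k) (chartFrame r k i le_rfl))
    have e1 : (pullback ζ ((linearFormHom hr c).1 (coordOpen k) (chartFrame r k i le_rfl))).1 j
        ⟨_, hmem⟩ = (weight ζ (r' j))⁻¹ * _ :=
      congrArg ((weight ζ (r' j))⁻¹ * ·) (linearFormHom_chartFrame hr c (le_refl (coordOpen k)) i j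
        ⟨_, mem_cone_coordOpen.mpr hu⟩)
    rw [e1] at e
    simp only [linearFormHom_apply] at e
    rw [Finset.sum_eq_single i (by simp +contextual [pullback, chartFrame]) (by simp)] at e
    have := weight_ne_zero ζ (r' j)
    have := weight_ne_zero ζ (r i)
    have := zpow_ne_zero (∑ l, r i l) (MuCubed.coord_ne_zero ζ k)
    simp [pullback, chartFrame, scaleVec, Pi.single_apply] at e
    field_simp at e
    simpa [hc, mul_comm] using e
  · ext j u
    simp only [linearFormHom_apply, pullback, Finset.mul_sum, Finset.sum_mul]
    refine Finset.sum_congr rfl fun i _ => Finset.sum_congr rfl fun k _ => ?_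
    by_cases hc : c (j, i, k) = 0
    · simp [hc]
    · have hw := hasInvariantWeight_iff.mp (h _ hc) ζ
      have := weight_ne_zero ζ (r i)
      have := MuCubed.coord_ne_zero ζ k
      rw [hw]
      simp only [scaleVec]
      field_simp

/-- If `f` enumerates the entries and the coordinates for which multiplication by the coordinate is
invariant, then the invariant homomorphisms are freely parametrized by the coefficients of these
coordinates. -/
noncomputable def equivariantHomEquiv {d : ℕ} [NeZero d] {A : Type} (f : A → κ × ι × Fin 3)
    (hf : Function.Injective f) (hrange : ∀ t, HasInvariantWeight d r r' t ↔ t ∈ Set.range f) :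
    (A → ℂ) ≃ₗ[ℂ] equivariantHom d r r' :=
  LinearEquiv.ofBijective
    ((linearFormHom hr ∘ₗ Function.ExtendByZero.linearMap ℂ f).codRestrict _ fun x =>
      (linearFormHom_mem_equivariantHom_iff hr _).mpr fun t ht => (hrange t).mpr <| by
        by_contra h
        exact ht (Function.extend_apply' (f := f) x 0 t h)) <| by
    constructor
    · intro x y h
      exact Function.extend_injective hf 0
        (linearFormHom_injective hr (congrArg Subtype.val h))
    · rintro ⟨φ, hφ⟩
      obtain ⟨c, rfl⟩ := linearFormHom_surjective hr φ
      rw [linearFormHom_mem_equivariantHom_iff] at hφ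
      refine ⟨c ∘ f, Subtype.ext (congrArg (linearFormHom hr) ?_)⟩
      funext t
      by_cases ht : t ∈ Set.range f
      · obtain ⟨a, rfl⟩ := ht
        exact hf.extend_apply _ _ a
      · rw [Function.ExtendByZero.linearMap_apply, Function.extend_apply' _ _ t ht]
        by_contra h
        exact ht ((hrange t).mp (hφ t (Ne.symm h)))

theorem coe_equivariantHomEquiv {d : ℕ} [NeZero d] {A : Type} (f : A → κ × ι × Fin 3)
    (hf : Function.Injective f) (hrange : ∀ t, HasInvariantWeight d r r' t ↔ t ∈ Set.range f)
    (x : A → ℂ) :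
    (equivariantHomEquiv hr f hf hrange x).1 = linearFormHom hr (Function.extend f x 0) := rfl

end Matrix

/-! ### Edges of the graph and invariant coordinates -/

section Dimer

variable {d : ℕ}

theorem sum_divisorE (b : Black d) : ∑ l, divisorE b l = -1 := by
  simp [divisorE, abelBlack, coordDivisor, Fin.sum_univ_three]

theorem sum_divisorF (w : White d) : ∑ l, divisorF w l = 0 := by
  simp [divisorF, abelWhite, coordDivisor, Fin.sum_univ_three]

theorem sum_divisorF_eq (w : White d) (b : Black d) :
    ∑ l, divisorF w l = 1 + ∑ l, divisorE b l := by
  rw [sum_divisorE, sum_divisorF]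
  rfl

/-- Different black vertices have divisors that differ modulo `d`, as `0 ≤ i, j < d`. -/
theorem eq_of_dvd_divisorE_sub {b b' : Black d}
    (h : ∀ l, (d : ℤ) ∣ divisorE b l - divisorE b' l) : b = b' := by
  have key (i j : Fin d) (hij : (d : ℤ) ∣ (i : ℤ) - j) : i = j := by
    have := Int.eq_zero_of_abs_lt_dvd hij (by rw [abs_lt]; omega)
    exact Fin.ext (by omega)
  have h1 := h 1
  have h2 := h 2
  simp [divisorE, abelBlack, coordDivisor] at h1 h2
  exact Prod.ext (key _ _ h1) (key _ _ h2)

variable [NeZero d]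

theorem val_sub_one_eq_add_ite (i : Fin d) :
    ((i - 1 : Fin d) : ℤ) = (i : ℤ) - 1 + d * if i = 0 then 1 else 0 := by
  split_ifs with h
  · subst h
    obtain ⟨n, rfl⟩ := Nat.exists_eq_succ_of_ne_zero (NeZero.ne d)
    simp
  · rw [val_sub_one i h, mul_zero, add_zero]

/-- Along an edge of type `k` the divisors `𝐝(b) - D + D_k` and `𝐝(w)` agree, up to `d (D₁ - D₀)` if
the edge has a factor `z` in the Kasteleyn matrix and `d (D₂ - D₀)` if it has a factor `w`. -/
theorem divisorE_black_add (e : Edge d) :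
    divisorE (Edge.black e) + coordDivisor e.2 = divisorF (Edge.white e) +
      ((d * Edge.crossZ e) • (coordDivisor 1 - coordDivisor 0) +
        (d * Edge.crossW e) • (coordDivisor 2 - coordDivisor 0)) := by
  obtain ⟨⟨i, j⟩, k⟩ := e
  funext l
  have hi := val_sub_one_eq_add_ite i
  have hj := val_sub_one_eq_add_ite j
  generalize hci : (if i = 0 then (1 : ℤ) else 0) = ci at hi
  generalize hcj : (if j = 0 then (1 : ℤ) else 0) = cj at hj
  fin_cases k <;> fin_cases l <;>
    simp [divisorE, divisorF, abelBlack, abelWhite, coordDivisor, Edge.black, Edge.white,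
      Edge.crossZ, Edge.crossW, hi, hj, hci, hcj, -mul_ite] <;> ring

/-- The entry of the matrix of linear forms and the coordinate that belong to an edge. -/
def edgeEntry (e : Edge d) : White d × Black d × Fin 3 := (Edge.white e, Edge.black e, e.2)

theorem edgeEntry_injective : Function.Injective (edgeEntry (d := d)) :=
  fun _ _ h => Prod.ext (congrArg (fun t => t.1) h) (congrArg (fun t => t.2.2) h)

/-- Multiplication by `x_k` is an invariant map `𝓔_b → 𝓕_w` exactly if the edge of type `k` at `w`
ends in `b`. -/
theorem hasInvariantWeight_iff_black {w : White d} {b : Black d} {k : Fin 3} :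
    HasInvariantWeight d (divisorE (d := d)) divisorF (w, b, k) ↔ Edge.black (w, k) = b := by
  have hdvd (l : Fin 3) :
      (d : ℤ) ∣ divisorF w l - (divisorE (Edge.black (w, k)) l + coordDivisor k l) := by
    have h := congrFun (divisorE_black_add (w, k)) l
    simp only [Pi.add_apply, Pi.smul_apply, smul_eq_mul] at h
    exact ⟨-(Edge.crossZ (w, k) * (coordDivisor 1 - coordDivisor 0) l +
      Edge.crossW (w, k) * (coordDivisor 2 - coordDivisor 0) l),
      by simp only [Edge.white] at h; linear_combination -h⟩
  constructor
  · intro h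
    refine eq_of_dvd_divisorE_sub fun l => ?_
    have := (h l).sub (hdvd l)
    rwa [sub_sub_sub_cancel_left, add_sub_add_right_eq_sub] at this
  · rintro rfl l
    exact hdvd l

theorem hasInvariantWeight_iff_mem_range (t : White d × Black d × Fin 3) :
    HasInvariantWeight d (divisorE (d := d)) divisorF t ↔ t ∈ Set.range edgeEntry := by
  obtain ⟨w, b, k⟩ := t
  rw [hasInvariantWeight_iff_black]
  constructor
  · rintro rfl
    exact ⟨(w, k), rfl⟩
  · rintro ⟨⟨w', k'⟩, h⟩
    simp only [edgeEntry, Prod.mk.injEq, Edge.white] at h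
    obtain ⟨rfl, h, rfl⟩ := h
    exact h

/-! ### Extending the Kasteleyn matrix -/

variable (d) in
/-- The isomorphism of `ℂ^E` with the space of invariant homomorphisms `𝓔 → 𝓕`: an edge of type `k`
contributes a multiple of `x_k`. -/
noncomputable def kasteleynEquiv :
    (Edge d → ℂ) ≃ₗ[ℂ] equivariantHom d (divisorE (d := d)) (divisorF (d := d)) :=
  equivariantHomEquiv sum_divisorF_eq edgeEntry edgeEntry_injective
    hasInvariantWeight_iff_mem_range

theorem extend_edgeEntry (x : Edge d → ℂ) (w : White d) (b : Black d) (k : Fin 3) :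
    Function.extend edgeEntry x 0 (w, b, k) = if Edge.black (w, k) = b then x (w, k) else 0 := by
  split_ifs with h
  · subst h
    exact edgeEntry_injective.extend_apply x 0 (w, k)
  · refine Function.extend_apply' _ _ _ fun ht => h ?_
    exact hasInvariantWeight_iff_black.mp ((hasInvariantWeight_iff_mem_range _).mpr ht)

theorem kasteleyn_apply (x : Edge d → ℂ) (z w : ℂ) (v : White d) (b : Black d) :
    kasteleyn x z w v b = ∑ k, if Edge.black (v, k) = b then
      x (v, k) * z ^ Edge.crossZ (v, k) * w ^ Edge.crossW (v, k) else 0 := by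
  rw [kasteleyn, Finset.sum_filter, Fintype.sum_prod_type, Finset.sum_eq_single v]
  · simp [Edge.white]
  · intro v' _ hv
    simp [Edge.white, hv]
  · simp

theorem torusFrame_ne_zero (a : Fin 3 → ℤ) {u : Fin 3 → ℂ} (hu : ∀ k, u k ≠ 0) :
    torusFrame a u ≠ 0 :=
  Finset.prod_ne_zero_iff.mpr fun k _ => zpow_ne_zero _ (hu k)

/-- In the trivializations over the torus, multiplication by the coordinate of an edge is the monomial
in `z` and `w` by which the edge enters the Kasteleyn matrix. -/
theorem coord_mul_torusFrame (e : Edge d) {u : Fin 3 → ℂ} (hu : ∀ k, u k ≠ 0) :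
    u e.2 * torusFrame (divisorE (Edge.black e)) u =
      ((u 1 / u 0) ^ d) ^ Edge.crossZ e * ((u 2 / u 0) ^ d) ^ Edge.crossW e *
        torusFrame (divisorF (Edge.white e)) u := by
  have hadd (a b : Fin 3 → ℤ) : torusFrame (a + b) u = torusFrame a u * torusFrame b u := by
    simp only [torusFrame, Pi.add_apply, zpow_add₀ (hu _), Finset.prod_mul_distrib]
  have hcoord (k : Fin 3) : torusFrame (coordDivisor k) u = u k := by
    rw [torusFrame, Finset.prod_eq_single k]
    · simp [coordDivisor]
    · intro l _ hl
      simp [coordDivisor, hl]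
    · simp
  have hsmul (n : ℤ) (k : Fin 3) :
      torusFrame ((d * n) • (coordDivisor k - coordDivisor 0)) u = ((u k / u 0) ^ d) ^ n := by
    have : torusFrame (coordDivisor k - coordDivisor 0) u = u k / u 0 := by
      rw [eq_div_iff (hu 0), ← hcoord 0, ← hadd, sub_add_cancel, hcoord]
    rw [← this, torusFrame, torusFrame, ← Finset.prod_pow, ← Finset.prod_zpow]
    refine Finset.prod_congr rfl fun l _ => ?_
    rw [Pi.smul_apply, smul_eq_mul, mul_comm, zpow_mul, zpow_mul, zpow_natCast]
  have h := congrArg (torusFrame · u) (divisorE_black_add e)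
  simp only [hadd, hsmul, hcoord] at h
  linear_combination h

theorem extendsKasteleyn_kasteleynEquiv (x : Edge d → ℂ) :
    ExtendsKasteleyn x (kasteleynEquiv d x).1 := by
  intro V s u hu v
  rw [kasteleynEquiv, coe_equivariantHomEquiv, linearFormHom_apply, Finset.sum_div]
  refine Finset.sum_congr rfl fun b _ => ?_
  rw [kasteleyn_apply, Finset.sum_mul, Finset.sum_mul, Finset.sum_div]
  refine Finset.sum_congr rfl fun k _ => ?_
  rw [extend_edgeEntry]
  split_ifs with h
  · subst h
    have e := coord_mul_torusFrame (v, k) hu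
    have h1 := torusFrame_ne_zero (divisorF v) hu
    have h2 := torusFrame_ne_zero (divisorE (Edge.black (v, k))) hu
    rw [← mul_div_assoc, div_eq_div_iff h1 h2]
    simp only [Edge.white] at e
    linear_combination x (v, k) * s.1 (Edge.black (v, k)) u * e
  · simp

/-- By density of the torus there is at most one extension. -/
theorem ExtendsKasteleyn.unique {x : Edge d → ℂ}
    {φ ψ : sheafHom (divisorE (d := d)) (divisorF (d := d))} (hφ : ExtendsKasteleyn x φ)
    (hψ : ExtendsKasteleyn x ψ) : φ = ψ := by
  ext V s v : 5
  refine ((φ.1 V s).2 v).eq_of_torus ((ψ.1 V s).2 v) fun u hu => ?_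
  have := (hφ V s u hu v).trans (hψ V s u hu v).symm
  exact (div_left_inj' (torusFrame_ne_zero _ hu)).mp this

/-! ### Dimensions of the spaces of invariant maps -/

theorem rank_equivariantHom (b : Black d) (w : White d) :
    Module.rank ℂ (equivariantHom d (fun _ : Unit => divisorE b) (fun _ : Unit => divisorF w)) =
      (Nat.card {e : Edge d // Edge.black e = b ∧ Edge.white e = w} : Cardinal) := by
  let f (e : {e : Edge d // Edge.black e = b ∧ Edge.white e = w}) : Unit × Unit × Fin 3 :=
    ((), (), e.1.2)
  have hf : Function.Injective f := fun e e' h =>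
    Subtype.ext (Prod.ext (e.2.2.trans e'.2.2.symm) (congrArg (fun t => t.2.2) h))
  have hrange (t : Unit × Unit × Fin 3) :
      HasInvariantWeight d (fun _ : Unit => divisorE b) (fun _ : Unit => divisorF w) t ↔
        t ∈ Set.range f := by
    obtain ⟨-, -, k⟩ := t
    refine (hasInvariantWeight_iff_black (w := w) (b := b) (k := k)).trans ⟨fun h => ?_, ?_⟩
    · exact ⟨⟨(w, k), h, rfl⟩, rfl⟩
    · rintro ⟨⟨⟨w', k'⟩, h, rfl⟩, hk⟩
      obtain rfl : k' = k := congrArg (fun t => t.2.2) hk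
      exact h
  have := (equivariantHomEquiv (d := d) (r := fun _ : Unit => divisorE b)
    (r' := fun _ : Unit => divisorF w) (fun _ _ => sum_divisorF_eq w b) f hf hrange).rank_eq
  rw [← this, rank_fun', Nat.card_eq_fintype_card]

/-- For `d ≥ 2` the graph has no multiple edges. -/
theorem edge_eq_of_black_eq (hd : 2 ≤ d) {e e' : Edge d} (hb : Edge.black e = Edge.black e')
    (hw : Edge.white e = Edge.white e') : e = e' := by
  obtain ⟨⟨i, j⟩, k⟩ := e
  obtain ⟨w, k'⟩ := e'
  obtain rfl : (i, j) = w := hw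
  have h1 : (1 : Fin d) ≠ 0 := by
    intro h
    have := congrArg Fin.val h
    rw [Fin.val_one', Nat.mod_eq_of_lt (by omega)] at this
    simp at this
  have h2 (i : Fin d) : i - 1 ≠ i := fun h => h1 (sub_eq_self.mp h)
  fin_cases k <;> fin_cases k' <;>
    first | rfl | simp [Edge.black, h2, (h2 _).symm] at hb

end Dimer

end DimerP2

theorem corollary4p2 (d : ℕ) [NeZero d] :
    (∃ Ktilde : (DimerP2.Edge d → ℂ) ≃ₗ[ℂ]
        DimerP2.equivariantHom d (DimerP2.divisorE (d := d)) (DimerP2.divisorF (d := d)),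
      ∀ (x : DimerP2.Edge d → ℂ)
        (φ : DimerP2.sheafHom (DimerP2.divisorE (d := d)) (DimerP2.divisorF (d := d))),
        DimerP2.ExtendsKasteleyn x φ ↔ φ = (Ktilde x).1) ∧
    (∀ φ ∈ DimerP2.equivariantHom d (DimerP2.divisorE (d := d)) (DimerP2.divisorF (d := d)),
      ∃ x : DimerP2.Edge d → ℂ, DimerP2.ExtendsKasteleyn x φ) ∧
    (∀ (b : DimerP2.Black d) (w : DimerP2.White d),
      Module.rank ℂ (DimerP2.equivariantHom d (fun _ : Unit => DimerP2.divisorE b)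
          (fun _ : Unit => DimerP2.divisorF w)) =
        (Nat.card {e : DimerP2.Edge d //
          DimerP2.Edge.black e = b ∧ DimerP2.Edge.white e = w} : Cardinal)) ∧
    (2 ≤ d → ∀ (b : DimerP2.Black d) (w : DimerP2.White d),
      (DimerP2.Adjacent b w →
        Module.rank ℂ (DimerP2.equivariantHom d (fun _ : Unit => DimerP2.divisorE b)
          (fun _ : Unit => DimerP2.divisorF w)) = 1) ∧
      (¬ DimerP2.Adjacent b w →
        Module.rank ℂ (DimerP2.equivariantHom d (fun _ : Unit => DimerP2.divisorE b)
          (fun _ : Unit => DimerP2.divisorF w)) = 0)) := by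
  refine ⟨⟨DimerP2.kasteleynEquiv d, fun x φ => ⟨fun h => ?_, ?_⟩⟩, fun φ hφ => ?_,
    DimerP2.rank_equivariantHom, fun hd b w => ⟨?_, fun h => ?_⟩⟩
  · exact h.unique (DimerP2.extendsKasteleyn_kasteleynEquiv x)
  · rintro rfl
    exact DimerP2.extendsKasteleyn_kasteleynEquiv x
  · refine ⟨(DimerP2.kasteleynEquiv d).symm ⟨φ, hφ⟩, ?_⟩
    simpa using DimerP2.extendsKasteleyn_kasteleynEquiv
      ((DimerP2.kasteleynEquiv d).symm ⟨φ, hφ⟩)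
  · rintro ⟨e, he⟩
    rw [DimerP2.rank_equivariantHom, Nat.card_eq_one_iff_unique.mpr, Nat.cast_one]
    exact ⟨⟨fun e₁ e₂ => Subtype.ext (DimerP2.edge_eq_of_black_eq hd
      (e₁.2.1.trans e₂.2.1.symm) (e₁.2.2.trans e₂.2.2.symm))⟩, ⟨e, he⟩⟩
  · rw [DimerP2.rank_equivariantHom, Nat.cast_eq_zero, Nat.card_eq_zero]
    exact Or.inl ⟨fun e => h ⟨e.1, e.2⟩⟩
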